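/- For a positive integer $n$, a partition of $n$ is an $n$-tuple $(a_1,\dots,a_n)$ of natural numbers with $a_1\ge a_2\ge\dots\ge a_n\ge 0$ and $a_1+\dots+a_n=n$. Let $\mathcal{L}_n$ be the lattice of all partitions of $n$ under the dominance ordering: $(a_1,\dots,a_n)\ge(b_1,\dots,b_n)$ if and only if $\sum_{i=1}^{j}a_i\ge\sum_{i=1}^{j}b_i$ for all $j$. An element $a$ of a lattice is join-irreducible if it is not the minimum element and $a=b\vee c$ implies $a=b$ or $a=c$; it is meet-irreducible if it is not the maximum element and $a=b\wedge c$ implies $a=b$ or $a=c$. Let $\mathcal{J}(\mathcal{L}_n)$ and $\mathcal{M}(\mathcal{L}_n)$ be the sets of join-irreducible and of meet-irreducible elements of $\mathcal{L}_n$, and let $\mathbb{K}(\mathcal{L}_n)=(\mathcal{J}(\mathcal{L}_n),\mathcal{M}(\mathcal{L}_n),\le)$ be the standard context of $\mathcal{L}_n$, with object set $\mathcal{J}(\mathcal{L}_n)$, attribute set $\mathcal{M}(\mathcal{L}_n)$ and the dominance ordering as incidence relation. Then: 1. For all $n\ge 1$, $$|\mathcal{J}(\mathcal{L}_{n+1})|=n\left(\left\lfloor\frac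 n3\right\rfloor+1\right)-\frac32\left\lfloor\frac n3\right\rfloor^2-\frac12\left\lfloor\frac n3\right\rfloor .$$ 2. As $n\to\infty$, the number of objects of $\mathbb{K}(\mathcal{L}_n)$ is $\Theta(n^2)$, and the number of attributes of $\mathbb{K}(\mathcal{L}_n)$ is $\Theta(n^2)$. -/

import Mathlib

/-- A partition of `n`: an `n`-tuple of natural numbers `a₁ ≥ a₂ ≥ … ≥ aₙ ≥ 0` with
`a₁ + a₂ + … + aₙ = n` (entries are indexed from `0` here). -/
@[ext]
structure IntPartition (n : ℕ) where
  parts : Fin n → ℕ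
  antitone_parts : ∀ i j : Fin n, i ≤ j → parts j ≤ parts i
  sum_parts : ∑ i : Fin n, parts i = n

namespace IntPartition

/-- The sum of the first `j` entries of a partition (entries beyond the `n`-th count as `0`). -/
def partialSum {n : ℕ} (a : IntPartition n) (j : ℕ) : ℕ :=
  ∑ i ∈ Finset.univ.filter (fun i : Fin n => (i : ℕ) < j), a.parts i

theorem partialSum_zero {n : ℕ} (a : IntPartition n) : a.partialSum 0 = 0 := by
  simp [partialSum]

theorem partialSum_of_le {n : ℕ} (a : IntPartition n) {j : ℕ} (h : n ≤ j) :
    a.partialSum j = n := by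
  rw [partialSum, Finset.filter_true_of_mem (fun i _ => lt_of_lt_of_le i.2 h), a.sum_parts]

theorem partialSum_succ {n : ℕ} (a : IntPartition n) (j : Fin n) :
    a.partialSum (j + 1) = a.partialSum j + a.parts j := by
  have h : (Finset.univ.filter fun i : Fin n => (i : ℕ) < j + 1)
      = insert j (Finset.univ.filter fun i : Fin n => (i : ℕ) < j) := by
    ext i
    simp only [Finset.mem_filter, Finset.mem_univ, true_and, Finset.mem_insert, Fin.ext_iff]
    omega
  rw [partialSum, h, Finset.sum_insert (by simp), partialSum, add_comm]

theorem partialSum_injective {n : ℕ} {a b : IntPartition n}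
    (h : ∀ j, a.partialSum j = b.partialSum j) : a = b := by
  ext j
  have h₁ := a.partialSum_succ j
  have h₂ := b.partialSum_succ j
  rw [h, h] at h₁
  omega

/-- The dominance ordering: `a ≤ b` if and only if every partial sum of `a` is at most the
corresponding partial sum of `b`. -/
instance instPartialOrder (n : ℕ) : PartialOrder (IntPartition n) where
  le a b := ∀ j, a.partialSum j ≤ b.partialSum j
  le_refl _ _ := le_rfl
  le_trans _ _ _ h₁ h₂ j := (h₁ j).trans (h₂ j)
  le_antisymm _ _ h₁ h₂ := partialSum_injective fun j => le_antisymm (h₁ j) (h₂ j)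

theorem le_def {n : ℕ} {a b : IntPartition n} :
    a ≤ b ↔ ∀ j, a.partialSum j ≤ b.partialSum j := Iff.rfl

/-- The partition `(n)`. -/
def single (n : ℕ) : IntPartition n where
  parts i := if (i : ℕ) = 0 then n else 0
  antitone_parts i j h := by
    have : (i : ℕ) ≤ j := h
    split_ifs <;> omega
  sum_parts := by
    cases n with
    | zero => simp
    | succ k => rw [Fin.sum_univ_succ]; simp

theorem le_single {n : ℕ} (a : IntPartition n) : a ≤ single n := by
  intro j
  rcases Nat.eq_zero_or_pos j with rfl | hj
  · simp [partialSum_zero]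
  · have h₁ : a.partialSum j ≤ n := by
      conv_rhs => rw [← a.sum_parts]
      exact Finset.sum_le_sum_of_subset (Finset.filter_subset _ _)
    have h₂ : n = (single n).partialSum j := by
      conv_lhs => rw [← (single n).sum_parts]
      symm
      refine Finset.sum_subset (Finset.filter_subset _ _) fun i _ hi => ?_
      simp only [Finset.mem_filter, Finset.mem_univ, true_and] at hi
      simp only [single]
      rw [if_neg (by omega)]
    omega

/-- Any nonempty set of partitions of `n` has a greatest lower bound for dominance. -/
theorem exists_isGLB {n : ℕ} (S : Set (IntPartition n)) (hS : S.Nonempty) :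
    ∃ c, IsGLB S c := by
  classical
  have hne : ∀ j, ((fun a : IntPartition n => a.partialSum j) '' S).Nonempty :=
    fun j => hS.image _
  set m : ℕ → ℕ := fun j => sInf ((fun a : IntPartition n => a.partialSum j) '' S) with hm
  have hle : ∀ a ∈ S, ∀ j, m j ≤ a.partialSum j := fun a ha j => Nat.sInf_le ⟨a, ha, rfl⟩
  have hatt : ∀ j, ∃ a ∈ S, a.partialSum j = m j := fun j => Nat.sInf_mem (hne j)
  have hm0 : m 0 = 0 := by
    obtain ⟨a, _, h⟩ := hatt 0
    rw [← h, partialSum_zero]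
  have hmn : ∀ j, n ≤ j → m j = n := fun j hj => by
    obtain ⟨a, _, h⟩ := hatt j
    rw [← h, partialSum_of_le a hj]
  have hstep : ∀ j, m j ≤ m (j + 1) := fun j => by
    obtain ⟨a, ha, h⟩ := hatt (j + 1)
    rw [← h]
    refine (hle a ha j).trans (Finset.sum_le_sum_of_subset ?_)
    intro i
    simp only [Finset.mem_filter, Finset.mem_univ, true_and]
    omega
  have hconc : ∀ j, m (j + 2) - m (j + 1) ≤ m (j + 1) - m j := fun j => by
    by_cases hj : n ≤ j + 1
    · rw [hmn (j + 2) (by omega), hmn (j + 1) hj]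
      omega
    · obtain ⟨a, ha, h⟩ := hatt (j + 1)
      have h₁ := a.partialSum_succ ⟨j, by omega⟩
      have h₂ := a.partialSum_succ ⟨j + 1, by omega⟩
      have h₃ := a.antitone_parts ⟨j, by omega⟩ ⟨j + 1, by omega⟩ (by simp)
      have h₄ := hle a ha j
      have h₅ := hle a ha (j + 2)
      simp only [add_assoc, Nat.reduceAdd] at h₁ h₂
      omega
  have hanti : Antitone fun j => m (j + 1) - m j := antitone_nat_of_succ_le hconc
  have hsum : ∀ j, ∑ i ∈ Finset.range j, (m (i + 1) - m i) = m j := fun j => by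
    rw [Finset.sum_range_tsub (monotone_nat_of_le_succ hstep), hm0, Nat.sub_zero]
  let c : IntPartition n :=
    { parts := fun i => m (i + 1) - m i
      antitone_parts := fun i j h => hanti h
      sum_parts := by
        rw [Fin.sum_univ_eq_sum_range (fun i => m (i + 1) - m i) n, hsum, hmn n le_rfl] }
  have hc : ∀ j, j ≤ n → c.partialSum j = m j := fun j => by
    induction j with
    | zero => intro _; rw [partialSum_zero, hm0]
    | succ j ih =>
      intro hj
      have h₁ := c.partialSum_succ ⟨j, by omega⟩
      have h₂ : c.parts ⟨j, by omega⟩ = m (j + 1) - m j := rfl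
      have h₃ := hstep j
      have h₄ := ih (by omega)
      simp only at h₁
      omega
  have hc' : ∀ j, c.partialSum j = m j := fun j => by
    rcases le_total j n with h | h
    · exact hc j h
    · rw [partialSum_of_le c h, hmn j h]
  refine ⟨c, fun a ha j => (hc' j).trans_le (hle a ha j), fun b hb j => ?_⟩
  obtain ⟨a, ha, h⟩ := hatt j
  rw [hc', ← h]
  exact hb ha j

theorem exists_isGLB_pair {n : ℕ} (a b : IntPartition n) : ∃ c, IsGLB {a, b} c :=
  exists_isGLB _ (Set.insert_nonempty _ _)

theorem exists_isLUB_pair {n : ℕ} (a b : IntPartition n) : ∃ c, IsLUB {a, b} c := by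
  obtain ⟨c, hc⟩ := exists_isGLB (upperBounds {a, b}) ⟨single n, fun x _ => le_single x⟩
  exact ⟨c, isGLB_upperBounds.mp hc⟩

/-- The lattice `Lₙ` of all partitions of `n` with the dominance ordering. -/
noncomputable instance instLattice (n : ℕ) : Lattice (IntPartition n) where
  sup a b := (exists_isLUB_pair a b).choose
  inf a b := (exists_isGLB_pair a b).choose
  le_sup_left a b := (exists_isLUB_pair a b).choose_spec.1 (by simp)
  le_sup_right a b := (exists_isLUB_pair a b).choose_spec.1 (by simp)
  sup_le a b _ h₁ h₂ := (exists_isLUB_pair a b).choose_spec.2 (by simp [h₁, h₂])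
  inf_le_left a b := (exists_isGLB_pair a b).choose_spec.1 (by simp)
  inf_le_right a b := (exists_isGLB_pair a b).choose_spec.1 (by simp)
  le_inf _ b c h₁ h₂ := (exists_isGLB_pair b c).choose_spec.2 (by simp [h₁, h₂])

end IntPartition

/-- The set of join-irreducible elements of a lattice. -/
def joinIrreducibles (L : Type*) [Lattice L] : Set L := {a | SupIrred a}

/-- The set of meet-irreducible elements of a lattice. -/
def meetIrreducibles (L : Type*) [Lattice L] : Set L := {a | InfIrred a}

/-- A formal context `(G, M, I)`: objects, attributes and an incidence relation. -/
structure FormalContext where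
  Objects : Type
  Attributes : Type
  Incidence : Objects → Attributes → Prop

/-- The standard context `(J(L), M(L), ≤)` of a lattice `L`. -/
def standardContext (L : Type) [Lattice L] : FormalContext where
  Objects := joinIrreducibles L
  Attributes := meetIrreducibles L
  Incidence g m := (g : L) ≤ (m : L)

/-! ### Partitions as concave sequences of partial sums -/

namespace IntPartition

variable {n : ℕ}

/-! The partial sums of a partition form a concave nondecreasing sequence from `0` to `n`, and
dominance is the pointwise order on these sequences.

Every partition is the infimum of its tangent lines truncated at `n`, so a meet-irreducible is one
of the at most `(n + 1) ^ 2` truncated lines (`exists_line_of_infIrred`). Conversely, quadratically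
many lines are meet-irreducible (`infIrred_line`).

Dually, among the partitions whose first `j` parts sum to at least `v` there is a least one,
described by `balancedSum`. Every partition is a supremum of these, so join-irreducibles are
balanced. A balanced partition is irreducible if its `j`-th partial sum can be lowered by one, that
is, if part `j`, equal to `v / j`, exceeds the next part by at least two. The next part is `1`, or
`0` when `v = n`, so `3 * j ≤ v`, or `v = n` and `2 * j ≤ v`, suffices. Partitions `2^r 1^k` with
`r, k > 0` are irreducible too and can be indexed with `v = n`; the remaining `3^r 2^s 1^k` are
proper joins. Counting the pairs (`supIrred_iff`, `balancedSum_index_le`) gives `n + ∑ v ≤ n, v / 3`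
for partitions of `n + 1`. -/

theorem partialSum_mono (a : IntPartition n) : Monotone a.partialSum := by
  refine monotone_nat_of_le_succ fun j => Finset.sum_le_sum_of_subset fun i => ?_
  simp only [Finset.mem_filter, Finset.mem_univ, true_and]
  omega

theorem partialSum_le (a : IntPartition n) (j : ℕ) : a.partialSum j ≤ n := by
  have h := a.partialSum_mono (le_max_left j n)
  rwa [a.partialSum_of_le (le_max_right j n)] at h

theorem partialSum_concave (a : IntPartition n) (j : ℕ) :
    a.partialSum j + a.partialSum (j + 2) ≤ 2 * a.partialSum (j + 1) := by
  by_cases hj : n ≤ j + 1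
  · have h₁ := a.partialSum_le j
    have h₂ := a.partialSum_le (j + 2)
    have h₃ := a.partialSum_of_le hj
    omega
  · have h₁ := a.partialSum_succ ⟨j, by omega⟩
    have h₂ := a.partialSum_succ ⟨j + 1, by omega⟩
    have h₃ := a.antitone_parts ⟨j, by omega⟩ ⟨j + 1, by omega⟩ (by simp)
    simp only [add_assoc, Nat.reduceAdd] at h₁ h₂
    omega

/-- A partition is below each of its tangent lines; the slope can be taken to be the next part. -/
theorem partialSum_le_tangent (a : IntPartition n) (m k : ℕ) :
    (a.partialSum k : ℤ) ≤ a.partialSum m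
      + ((a.partialSum (m + 1) : ℤ) - a.partialSum m) * ((k : ℤ) - m) := by
  set d : ℕ → ℤ := fun i => (a.partialSum (i + 1) : ℤ) - a.partialSum i with hd
  have hanti : Antitone d := antitone_nat_of_succ_le fun i => by
    have := a.partialSum_concave i
    simp only [hd, add_assoc, Nat.reduceAdd]
    omega
  rcases le_total m k with h | h
  · induction k, h using Nat.le_induction with
    | base => simp
    | succ k hk ih =>
      have h₁ := hanti hk
      have h₂ : (a.partialSum (k + 1) : ℤ) = a.partialSum k + d k := by simp [hd]
      push_cast
      change _ ≤ _ + d m * _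
      change _ ≤ _ + d m * _ at ih
      linarith
  · induction h using Nat.decreasingInduction with
    | self => simp
    | of_succ k hk ih =>
      have h₁ := hanti (show k ≤ m by omega)
      have h₂ : (a.partialSum (k + 1) : ℤ) = a.partialSum k + d k := by simp [hd]
      push_cast at ih
      change _ ≤ _ + d m * _
      change _ ≤ _ + d m * _ at ih
      linarith

/-- Every line of support of a partition has a natural slope and a natural intercept. -/
theorem exists_tangent (a : IntPartition n) (m : ℕ) :
    ∃ s c : ℕ, a.partialSum m = m * s + c ∧ ∀ k, a.partialSum k ≤ k * s + c := by
  have h := a.partialSum_le_tangent m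
  have hs := a.partialSum_mono (Nat.le_succ m)
  obtain ⟨s, hs⟩ := Nat.exists_eq_add_of_le hs
  have h₀ := h 0
  rw [Nat.succ_eq_add_one] at hs
  rw [hs, partialSum_zero] at h₀
  push_cast at h₀
  have h₁ : m * s ≤ a.partialSum m := by zify; linarith
  obtain ⟨c, hc⟩ := Nat.exists_eq_add_of_le h₁
  refine ⟨s, c, hc, fun k => ?_⟩
  have h₂ := h k
  rw [hs, hc] at h₂
  push_cast at h₂
  zify
  linarith

/-- Parts stay positive until the total is exhausted: a zero part makes the tangent horizontal, so
the sum is already `n`. -/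
theorem min_add_le_partialSum (a : IntPartition n) (j d : ℕ) :
    min n (a.partialSum j + d) ≤ a.partialSum (j + d) := by
  induction d with
  | zero => simp
  | succ d ih =>
    have hm := a.partialSum_mono (show j + d ≤ j + (d + 1) by omega)
    have ht := a.partialSum_le_tangent (j + d) n
    rw [partialSum_of_le a le_rfl] at ht
    by_cases he : a.partialSum (j + d + 1) = a.partialSum (j + d)
    · rw [he, sub_self, zero_mul] at ht
      omega
    · rw [add_assoc] at he
      omega

theorem min_le_partialSum (a : IntPartition n) (j : ℕ) : min n j ≤ a.partialSum j := by
  simpa [partialSum_zero] using a.min_add_le_partialSum 0 j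

/-- The partition of `n` with prescribed partial sums. -/
def ofPartialSum (n : ℕ) (f : ℕ → ℕ) (h0 : f 0 = 0) (hn : f n = n) (hmono : Monotone f)
    (hconc : ∀ j, f j + f (j + 2) ≤ 2 * f (j + 1)) : IntPartition n where
  parts i := f (i + 1) - f i
  antitone_parts i j h := by
    have hanti : Antitone fun j => f (j + 1) - f j := antitone_nat_of_succ_le fun i => by
      have := hconc i
      simp only [add_assoc, Nat.reduceAdd]
      omega
    exact hanti h
  sum_parts := by
    rw [Fin.sum_univ_eq_sum_range (fun i => f (i + 1) - f i) n, Finset.sum_range_tsub hmono, h0,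
      hn, Nat.sub_zero]

theorem partialSum_ofPartialSum {f : ℕ → ℕ} (h0 : f 0 = 0) (hn : f n = n) (hmono : Monotone f)
    (hconc : ∀ j, f j + f (j + 2) ≤ 2 * f (j + 1)) {j : ℕ} (hj : j ≤ n) :
    (ofPartialSum n f h0 hn hmono hconc).partialSum j = f j := by
  induction j with
  | zero => rw [partialSum_zero, h0]
  | succ j ih =>
    have h₁ := (ofPartialSum n f h0 hn hmono hconc).partialSum_succ ⟨j, by omega⟩
    have h₂ : (ofPartialSum n f h0 hn hmono hconc).parts ⟨j, by omega⟩ = f (j + 1) - f j := rfl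
    have h₃ := hmono (Nat.le_succ j)
    have h₄ := ih (by omega)
    simp only [Nat.succ_eq_add_one] at h₁ h₃
    omega

theorem exists_partialSum_eq (f : ℕ → ℕ) (h0 : f 0 = 0) (hn : ∀ j, n ≤ j → f j = n)
    (hmono : ∀ j, f j ≤ f (j + 1)) (hconc : ∀ j, f j + f (j + 2) ≤ 2 * f (j + 1)) :
    ∃ a : IntPartition n, ∀ j, a.partialSum j = f j := by
  refine ⟨ofPartialSum n f h0 (hn n le_rfl) (monotone_nat_of_le_succ hmono) hconc, fun j => ?_⟩
  rcases le_total j n with h | h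
  · exact partialSum_ofPartialSum _ _ _ _ h
  · rw [partialSum_of_le _ h, hn j h]

/-- Lower bounds on `Nat.card` need finiteness, since it is `0` on infinite types. -/
instance instFinite (n : ℕ) : Finite (IntPartition n) := by
  refine Finite.of_injective (β := Fin (n + 1) → Fin (n + 1))
    (fun a j => ⟨a.partialSum j, Nat.lt_succ_of_le (a.partialSum_le j)⟩) fun a b h => ?_
  refine partialSum_injective fun j => ?_
  rcases le_total j n with hj | hj
  · have := congrFun h ⟨j, Nat.lt_succ_of_le hj⟩
    simpa using this
  · rw [partialSum_of_le a hj, partialSum_of_le b hj]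

instance instOrderTop (n : ℕ) : OrderTop (IntPartition n) where
  top := single n
  le_top := le_single

theorem exists_partialSum_eq_min (n : ℕ) :
    ∃ a : IntPartition n, ∀ j, a.partialSum j = min n j :=
  exists_partialSum_eq _ (by simp) (fun j h => by simp [h]) (fun j => by omega)
    (fun j => by omega)

noncomputable instance instOrderBot (n : ℕ) : OrderBot (IntPartition n) where
  bot := (exists_partialSum_eq_min n).choose
  bot_le a j := by
    rw [(exists_partialSum_eq_min n).choose_spec]
    exact a.min_le_partialSum j

end IntPartition

/-! ### Criteria for irreducibility -/

/-- A single `m` bounds everything strictly below `x`, hence also any join of two such elements.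
Non-minimality comes from `x ⊓ m`. -/
theorem supIrred_of_forall_le {L : Type*} [Lattice L] {x m : L} (hm : ¬ x ≤ m)
    (h : ∀ b ≤ x, b ≠ x → b ≤ m) : SupIrred x := by
  refine ⟨fun hx => hm ((hx inf_le_left).trans inf_le_right), fun b c hbc => ?_⟩
  by_contra! hne
  exact hm (hbc ▸ sup_le (h b (hbc ▸ le_sup_left) hne.1) (h c (hbc ▸ le_sup_right) hne.2))

theorem infIrred_of_forall_le {L : Type*} [Lattice L] {x m : L} (hm : ¬ m ≤ x)
    (h : ∀ b, x ≤ b → b ≠ x → m ≤ b) : InfIrred x := by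
  refine ⟨fun hx => hm (le_sup_right.trans (hx le_sup_left)), fun b c hbc => ?_⟩
  by_contra! hne
  exact hm (hbc ▸ le_inf (h b (hbc ▸ inf_le_left) hne.1) (h c (hbc ▸ inf_le_right) hne.2))

/-! ### Meet-irreducibles as truncated lines -/

namespace IntPartition

variable {n : ℕ}

/-- The largest partition of `n` below the line `k ↦ k * s + c`. -/
theorem exists_line {s c : ℕ} (h : n ≤ n * s + c) : ∃ a : IntPartition n,
    ∀ k, a.partialSum k = if k = 0 then 0 else min (k * s + c) n := by
  refine exists_partialSum_eq _ (by simp) (fun j hj => ?_) (fun j => ?_) fun j => ?_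
  · have := Nat.mul_le_mul_right s hj
    split_ifs <;> first | contradiction | omega
  · rw [add_mul]
    split_ifs <;> first | contradiction | omega
  · rw [add_mul, add_mul]
    rcases Nat.eq_zero_or_pos j with rfl | hj
    · simp only [zero_mul, if_true]
      split_ifs <;> first | contradiction | omega
    · split_ifs <;> first | contradiction | omega

theorem exists_line_of_infIrred {a : IntPartition n} (ha : InfIrred a) :
    ∃ p : Fin (n + 1) × Fin (n + 1),
      ∀ k, a.partialSum k = if k = 0 then 0 else min (k * p.1 + p.2) n := by
  have key : ∀ m ∈ Finset.Icc 1 n, ∃ t : IntPartition n, ∃ p : Fin (n + 1) × Fin (n + 1),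
      a ≤ t ∧ t.partialSum m = a.partialSum m ∧
        ∀ k, t.partialSum k = if k = 0 then 0 else min (k * p.1 + p.2) n := fun m hm => by
    rw [Finset.mem_Icc] at hm
    obtain ⟨s, c, hsc, hle⟩ := a.exists_tangent m
    obtain ⟨t, ht⟩ := exists_line (n := n) (s := s) (c := c) (by
      have := hle n
      rwa [partialSum_of_le a le_rfl] at this)
    have h₁ := a.partialSum_le m
    have h₂ : s ≤ m * s := Nat.le_mul_of_pos_left s (by omega)
    refine ⟨t, (⟨s, by omega⟩, ⟨c, by omega⟩), fun k => ?_, ?_, ht⟩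
    · rw [ht]
      have h₃ := a.partialSum_le k
      have h₄ := hle k
      split_ifs with hk
      · rw [hk, partialSum_zero]
      · omega
    · rw [ht, if_neg (by omega)]
      omega
  choose! t p hle heq hline using key
  obtain ⟨m, hm, h⟩ := ha.finset_inf_eq (s := Finset.Icc 1 n) (f := t) (by
    refine le_antisymm (fun k => ?_) (Finset.le_inf hle)
    rcases Nat.eq_zero_or_pos k with rfl | hk
    · simp [partialSum_zero]
    rcases le_total n k with hn | hn
    · rw [partialSum_of_le _ hn, partialSum_of_le _ hn]
    · have hkn := Finset.mem_Icc.2 ⟨hk, hn⟩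
      rw [← heq k hkn]
      exact Finset.inf_le (f := t) hkn k)
  exact ⟨p m, fun k => by rw [← h, hline m hm k]⟩

theorem card_meetIrreducibles_le (n : ℕ) :
    Nat.card (meetIrreducibles (IntPartition n)) ≤ (n + 1) ^ 2 := by
  choose p hp using fun a : meetIrreducibles (IntPartition n) => exists_line_of_infIrred a.2
  have hinj : Function.Injective p := fun a b h => by
    refine Subtype.ext (partialSum_injective fun k => ?_)
    rw [hp, hp, h]
  simpa [sq] using Nat.card_le_card_of_injective p hinj

theorem infIrred_line {s c : ℕ} (hs : 1 ≤ s) (hc : 1 ≤ c) (hsc : 3 * s + c ≤ n)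
    {a : IntPartition n} (ha : ∀ k, a.partialSum k = if k = 0 then 0 else min (k * s + c) n) :
    InfIrred a := by
  -- The least partition strictly above `a`: the line raised by one strictly between its first point
  -- and the cut-off. The hypothesis `3 * s + c ≤ n` ensures that `k = 2` is raised.
  obtain ⟨b, hb⟩ : ∃ b : IntPartition n, ∀ k, b.partialSum k =
      if k = 0 then 0 else if k = 1 then s + c else
        if (k + 1) * s + c ≤ n then k * s + c + 1 else min (k * s + c) n := by
    refine exists_partialSum_eq _ (by simp) (fun j hj => ?_) (fun j => ?_) fun j => ?_
    · have h₁ : j ≤ j * s := Nat.le_mul_of_pos_right j hs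
      simp only [add_mul]
      split_ifs <;> first | contradiction | omega
    · simp only [add_mul]
      have h₁ : j = 1 → j * s = s := by rintro rfl; simp
      split_ifs <;> first | contradiction | omega
    · simp only [add_mul]
      rcases Nat.eq_zero_or_pos j with rfl | hj
      · simp only [zero_mul, if_true]
        split_ifs <;> first | contradiction | omega
      rcases eq_or_lt_of_le (Nat.succ_le_of_lt hj) with rfl | hj
      · simp only [Nat.succ_eq_add_one, zero_add, one_mul, if_true]
        split_ifs <;> first | contradiction | omega
      · split_ifs <;> first | contradiction | omega
  refine infIrred_of_forall_le (m := b) (fun h => ?_) fun z hz hne k => ?_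
  · have := h 2
    rw [ha, hb] at this
    simp only [OfNat.ofNat_ne_zero, if_false, OfNat.ofNat_ne_one, Nat.reduceAdd] at this
    split_ifs at this
    omega
  · have hzk := hz k
    rw [ha] at hzk
    rw [hb]
    split_ifs with h₀ h₁ hk
    · omega
    · subst h₁
      simp only [one_ne_zero, if_false] at hzk
      omega
    · rw [if_neg h₀] at hzk
      by_contra! hlt
      have hks : (k + 1) * s = k * s + s := by ring
      have hzk' : z.partialSum k = k * s + c := by omega
      refine hne (le_antisymm (fun i => ?_) hz)
      rw [ha]
      split_ifs with hi
      · rw [hi, partialSum_zero]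
      -- Where `z` touches the line at `k`, its tangent must clear the line at `1` and at `k + 1`.
      -- The first forces slope at most `s`, the second at least `s`, so all of `z` lies under the
      -- line.
      have ht := z.partialSum_le_tangent k
      set d := (z.partialSum (k + 1) : ℤ) - z.partialSum k with hd
      have h1 := hz 1
      have h2 := hz (k + 1)
      rw [ha, if_neg (by omega), min_eq_left (by omega)] at h1 h2
      have hds : (s : ℤ) ≤ d := by
        zify at h2 hzk'
        linarith
      have hds' : d ≤ s := by
        have h3 := ht 1
        zify at h1 hzk'
        push_cast at h3
        have hk2 : (2 : ℤ) ≤ k := by omega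
        by_contra! hlt'
        nlinarith
      have hdd : d = s := le_antisymm hds' hds
      have h4 := ht i
      rw [hdd] at h4
      have h5 := z.partialSum_le i
      have h6 : z.partialSum i ≤ i * s + c := by
        zify at hzk' ⊢
        linarith
      omega
    · rwa [if_neg h₀] at hzk

/-- Slopes up to `n / 6` and intercepts up to `n / 2` satisfy `3 * s + c ≤ n`; the partial sums at
`1` and `2` recover both. -/
theorem le_card_meetIrreducibles (n : ℕ) :
    (n / 6) * (n / 2) ≤ Nat.card (meetIrreducibles (IntPartition n)) := by
  have key : ∀ p : Fin (n / 6) × Fin (n / 2), ∃ a : meetIrreducibles (IntPartition n),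
      ∀ k, a.1.partialSum k = if k = 0 then 0 else min (k * (p.1 + 1) + (p.2 + 1)) n := by
    rintro ⟨⟨s, hs⟩, ⟨c, hc⟩⟩
    obtain ⟨a, ha⟩ := exists_line (n := n) (s := s + 1) (c := c + 1)
      ((Nat.le_mul_of_pos_right n (by omega)).trans (Nat.le_add_right _ _))
    exact ⟨⟨a, infIrred_line (by omega) (by omega) (by omega) ha⟩, ha⟩
  choose f hf using key
  have hinj : Function.Injective f := by
    rintro ⟨⟨s, hs⟩, ⟨c, hc⟩⟩ ⟨⟨s', hs'⟩, ⟨c', hc'⟩⟩ h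
    have h₁ := (hf _ 1).symm.trans ((congrArg (fun a => a.1.partialSum 1) h).trans (hf _ 1))
    have h₂ := (hf _ 2).symm.trans ((congrArg (fun a => a.1.partialSum 2) h).trans (hf _ 2))
    simp only [one_ne_zero, OfNat.ofNat_ne_zero, if_false] at h₁ h₂
    simp only [Prod.mk.injEq, Fin.mk.injEq]
    omega
  simpa using Nat.card_le_card_of_injective f hinj

end IntPartition

/-! ### Join-irreducibles as balanced partitions -/

/-- The partial sums of the partition of `n` that starts with `v` distributed as evenly as
possible over `j` parts and continues with ones. -/
def balancedSum (n j v i : ℕ) : ℕ :=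
  if i ≤ j then i * (v / j) + min i (v % j) else min n (v + (i - j))

theorem balancedSum_zero (n j v : ℕ) : balancedSum n j v 0 = 0 := by simp [balancedSum]

theorem balancedSum_self (n : ℕ) {j : ℕ} (v : ℕ) (hj : 1 ≤ j) : balancedSum n j v j = v := by
  have h₁ := Nat.div_add_mod v j
  have h₂ := Nat.mod_lt v hj
  rw [balancedSum, if_pos le_rfl, min_eq_right h₂.le, h₁]

theorem balancedSum_of_le (n v : ℕ) {i j : ℕ} (h : i ≤ j) :
    balancedSum n j v i = i * (v / j) + min i (v % j) := if_pos h

theorem balancedSum_of_ge {n i j v : ℕ} (hj : 1 ≤ j) (hv : v ≤ n) (h : j ≤ i) :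
    balancedSum n j v i = min n (v + (i - j)) := by
  rcases eq_or_lt_of_le h with rfl | h
  · rw [balancedSum_self n v hj]
    omega
  · exact if_neg (by omega)

/-- The remainder is less than `j`, so part `j` is the bare quotient. -/
theorem balancedSum_pred {n i j v : ℕ} (h : i + 1 = j) :
    balancedSum n j v i + v / j = v := by
  have h₁ := Nat.div_add_mod v j
  have h₂ := Nat.mod_lt v (show 0 < j by omega)
  rw [balancedSum_of_le n v (by omega), min_eq_right (by omega)]
  subst h
  rw [add_mul] at h₁
  omega

/-- Inside the evenly distributed part, consecutive parts differ by at most one. -/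
theorem balancedSum_gap {n i j v : ℕ} (h : i + 2 ≤ j) :
    2 * balancedSum n j v (i + 1) ≤ balancedSum n j v i + balancedSum n j v (i + 2) + 1 := by
  rw [balancedSum_of_le n v (by omega), balancedSum_of_le n v (by omega), balancedSum_of_le n v h,
    add_mul, add_mul]
  omega

namespace IntPartition

variable {n : ℕ}

theorem exists_balanced {j v : ℕ} (hj : 1 ≤ j) (hjv : j ≤ v) (hv : v ≤ n) :
    ∃ a : IntPartition n, ∀ i, a.partialSum i = balancedSum n j v i := by
  have hq : 1 ≤ v / j := (Nat.one_le_div_iff hj).2 hjv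
  refine exists_partialSum_eq _ (balancedSum_zero n j v) (fun i hi => ?_) (fun i => ?_) fun i => ?_
  · rw [balancedSum_of_ge hj hv (by omega)]
    omega
  · rcases lt_or_ge i j with h | h
    · rw [balancedSum_of_le n v h.le, balancedSum_of_le n v h, Nat.succ_mul]
      omega
    · rw [balancedSum_of_ge hj hv h, balancedSum_of_ge hj hv (by omega)]
      omega
  · rcases lt_trichotomy (i + 1) j with h | h | h
    · rw [balancedSum_of_le n v h.le, balancedSum_of_le n v (show i ≤ j by omega),
        balancedSum_of_le n v (show i + 2 ≤ j by omega), add_mul, add_mul]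
      omega
    · have h₁ := balancedSum_pred (n := n) (v := v) h
      have h₂ := balancedSum_self n v hj
      rw [h, balancedSum_of_ge hj hv (show j ≤ i + 2 by omega), h₂]
      omega
    · rw [balancedSum_of_ge hj hv (show j ≤ i by omega), balancedSum_of_ge hj hv h.le,
        balancedSum_of_ge hj hv (show j ≤ i + 2 by omega)]
      omega

/-- The evenly distributed partition is the least one whose first `j` parts sum to `v`. -/
theorem balancedSum_le_partialSum (a : IntPartition n) {j v : ℕ} (hj : 1 ≤ j) (hv : v ≤ n)
    (h : v ≤ a.partialSum j) (i : ℕ) : balancedSum n j v i ≤ a.partialSum i := by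
  rcases le_total i j with hi | hi
  · rw [balancedSum_of_le n v hi]
    obtain ⟨s, c, hsc, hle⟩ := a.exists_tangent i
    have h₁ := hle j
    have h₂ := Nat.div_add_mod v j
    -- A steep tangent at `i` makes the first `i` parts large enough on their own; a shallow one
    -- limits the growth from `i` to `j`, so most of `v` is already reached at `i`.
    rcases Nat.lt_or_ge (v / j) s with hs | hs
    · have h₃ : i * (v / j + 1) ≤ i * s := Nat.mul_le_mul_left i hs
      rw [mul_add] at h₃
      omega
    · obtain ⟨d, rfl⟩ := Nat.exists_eq_add_of_le hi
      have h₃ : d * s ≤ d * (v / (i + d)) := Nat.mul_le_mul_left d hs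
      rw [add_mul] at h₁ h₂
      omega
  · rw [balancedSum_of_ge hj hv hi]
    obtain ⟨d, rfl⟩ := Nat.exists_eq_add_of_le hi
    have := a.min_add_le_partialSum j d
    omega

theorem balanced_le_iff {a x : IntPartition n} {j v : ℕ} (hj : 1 ≤ j) (hv : v ≤ n)
    (hx : ∀ i, x.partialSum i = balancedSum n j v i) : x ≤ a ↔ v ≤ a.partialSum j := by
  refine ⟨fun h => ?_, fun h i => (hx i).trans_le (a.balancedSum_le_partialSum hj hv h i)⟩
  have := h j
  rwa [hx, balancedSum_self n v hj] at this

theorem exists_balanced_of_supIrred {a : IntPartition n} (ha : SupIrred a) :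
    ∃ j v, 1 ≤ j ∧ j < v ∧ v ≤ n ∧ ∀ i, a.partialSum i = balancedSum n j v i := by
  have key : ∀ j ∈ Finset.Icc 1 n, ∃ t : IntPartition n,
      ∀ i, t.partialSum i = balancedSum n j (a.partialSum j) i := fun j hj => by
    rw [Finset.mem_Icc] at hj
    have := a.min_le_partialSum j
    exact exists_balanced hj.1 (by omega) (a.partialSum_le j)
  choose! t ht using key
  obtain ⟨j, hj, h⟩ := ha.finset_sup_eq (s := Finset.Icc 1 n) (f := t) (by
    refine le_antisymm (Finset.sup_le fun j hj => ?_) fun k => ?_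
    · exact (balanced_le_iff (Finset.mem_Icc.1 hj).1 (a.partialSum_le j) (ht j hj)).2 le_rfl
    · rcases Nat.eq_zero_or_pos k with rfl | hk
      · simp [partialSum_zero]
      rcases le_total n k with hn | hn
      · rw [partialSum_of_le _ hn, partialSum_of_le _ hn]
      · have hkn := Finset.mem_Icc.2 ⟨hk, hn⟩
        exact (balanced_le_iff hk (a.partialSum_le k) (ht k hkn)).1 (Finset.le_sup (f := t) hkn))
  have hx : ∀ i, a.partialSum i = balancedSum n j (a.partialSum j) i := fun i => by
    rw [← ht j hj, h]
  rw [Finset.mem_Icc] at hj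
  refine ⟨j, a.partialSum j, hj.1, ?_, a.partialSum_le j, hx⟩
  by_contra! hle
  -- With `v ≤ j` the condition `v ≤ b.partialSum j` always holds, so `a` would be the minimum.
  exact ha.1 fun b _ => (balanced_le_iff hj.1 (a.partialSum_le j) hx).2
    (by have := b.min_le_partialSum j; omega)

/-- Partitions `3^r 2^(j - r) 1^k` with `0 < r < j` and `0 < k` are not join-irreducible. -/
theorem not_supIrred_balanced {x : IntPartition n} {j r : ℕ} (hr : 1 ≤ r) (hrj : r < j)
    (hv : 2 * j + r < n) (hx : ∀ i, x.partialSum i = balancedSum n j (2 * j + r) i) :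
    ¬ SupIrred x := by
  intro h
  have hdiv : (2 * j + r) / j = 2 := by
    rw [Nat.div_eq_iff (by omega)]
    omega
  have hmod : (2 * j + r) % j = r := by
    rw [mul_comm, Nat.mul_add_mod, Nat.mod_eq_of_lt hrj]
  have hxj : x.partialSum j = 2 * j + r := by rw [hx, balancedSum_self n _ (by omega)]
  -- With `v = 2 * j + r`, both `b` and `c` reach only `v - 1` at `j`. Concavity of their join at
  -- `j` gives twice its value there at least `(v - 2) + (v + 1)`, hence the value is at least `v`.
  obtain ⟨b, hb⟩ := exists_balanced (n := n) (j := j - 1) (v := 2 * j + r - 2)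
    (by omega) (by omega) (by omega)
  obtain ⟨c, hc⟩ := exists_balanced (n := n) (j := j + 1) (v := 2 * j + r + 1)
    (by omega) (by omega) (by omega)
  have hbx : b ≤ x := by
    rw [balanced_le_iff (by omega) (by omega) hb, hx, balancedSum_of_le _ _ (by omega), hdiv, hmod]
    omega
  have hcx : c ≤ x := by
    rw [balanced_le_iff (by omega) (by omega) hc, hx,
      balancedSum_of_ge (by omega) (by omega) (by omega)]
    omega
  have hsup : b ⊔ c = x := by
    refine le_antisymm (sup_le hbx hcx) ?_
    rw [balanced_le_iff (by omega) (by omega) hx]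
    have h₁ := (balanced_le_iff (by omega) (by omega) hb).1 (le_sup_left : b ≤ b ⊔ c)
    have h₂ := (balanced_le_iff (by omega) (by omega) hc).1 (le_sup_right : c ≤ b ⊔ c)
    have h₃ := (b ⊔ c).partialSum_concave (j - 1)
    rw [show j - 1 + 2 = j + 1 by omega, show j - 1 + 1 = j by omega] at h₃
    omega
  rcases h.2 hsup with rfl | rfl
  · rw [hb, balancedSum_of_ge (by omega) (by omega) (by omega)] at hxj
    omega
  · have hdiv' : (2 * j + r + 1) / (j + 1) = 2 := by
      rw [Nat.div_eq_iff (by omega)]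
      omega
    have h₁ := balancedSum_pred (n := n) (v := 2 * j + r + 1) (rfl : j + 1 = j + 1)
    rw [← hc, hxj, hdiv'] at h₁
    omega

/-- A partition `2^r 1^k` is itself an even distribution of `n`. -/
theorem balancedSum_eq_of_le_two_mul {j v : ℕ} (hjv : j < v) (hv : v ≤ 2 * j) (hvn : v < n)
    (i : ℕ) : balancedSum n j v i = balancedSum n (n - (v - j)) n i := by
  obtain ⟨r, rfl⟩ := Nat.exists_eq_add_of_le hjv.le
  obtain ⟨k, rfl⟩ := Nat.exists_eq_add_of_lt hvn
  have h₁ : (j + r + k + 1) / (j + k + 1) = 1 := by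
    rw [Nat.div_eq_iff (by omega)]
    omega
  have h₂ : (j + r + k + 1) % (j + k + 1) = r := by
    rw [show j + r + k + 1 = j + k + 1 + r by ring, Nat.add_mod_left, Nat.mod_eq_of_lt (by omega)]
  rw [show j + r + k + 1 - (j + r - j) = j + k + 1 by omega]
  rcases lt_or_eq_of_le hv with hv | hv
  · have h₃ : (j + r) / j = 1 := by
      rw [Nat.div_eq_iff (by omega)]
      omega
    have h₄ : (j + r) % j = r := by
      rw [Nat.add_mod_left, Nat.mod_eq_of_lt (by omega)]
    simp only [balancedSum, h₁, h₂, h₃, h₄]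
    split_ifs <;> omega
  · obtain rfl : r = j := by omega
    have h₃ : (r + r) / r = 2 := by
      rw [← two_mul, Nat.mul_div_cancel _ (by omega)]
    have h₄ : (r + r) % r = 0 := by simp
    simp only [balancedSum, h₁, h₂, h₃, h₄]
    split_ifs <;> omega

theorem supIrred_balanced {x : IntPartition n} {j v : ℕ} (hj : 1 ≤ j) (hjv : 2 * j ≤ v)
    (hv : v ≤ n) (hjn : v = n ∨ 3 * j ≤ v) (hx : ∀ i, x.partialSum i = balancedSum n j v i) :
    SupIrred x := by
  have hxj : x.partialSum j = v := by rw [hx, balancedSum_self n v hj]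
  have hq : 2 ≤ v / j := (Nat.le_div_iff_mul_le hj).2 hjv
  have hq' : v = n ∨ 3 ≤ v / j := hjn.imp_right (Nat.le_div_iff_mul_le hj).2
  -- Lowering the value at `j` threatens concavity only at `j`, where part `j` loses one and the
  -- next part gains one; `hq` and `hq'` supply the gap of two.
  obtain ⟨m, hm⟩ : ∃ m : IntPartition n, ∀ i, m.partialSum i =
      if i = j then v - 1 else x.partialSum i := by
    have hpred : ∀ i, i + 1 = j → x.partialSum i + v / j = v := fun i hi => by
      rw [hx]; exact balancedSum_pred hi
    have hsucc : ∀ i, j ≤ i → x.partialSum i = min n (v + (i - j)) := fun i hi => by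
      rw [hx, balancedSum_of_ge hj hv hi]
    refine exists_partialSum_eq _ ?_ (fun i hi => ?_) (fun i => ?_) fun i => ?_
    · rw [if_neg (by omega), partialSum_zero]
    · have : j < n := by omega
      rw [if_neg (by omega), partialSum_of_le _ hi]
    · have h₁ := hpred i
      have h₂ := hsucc (i + 1)
      have h₃ := x.partialSum_mono (Nat.le_succ i)
      rw [Nat.succ_eq_add_one] at h₃
      split_ifs <;> first | contradiction | omega
    · have h₁ := hpred i
      have h₂ := hsucc (i + 1)
      have h₃ := hsucc (i + 2)
      have h₄ := x.partialSum_concave i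
      have h₅ := hsucc i
      by_cases hi : i + 2 = j
      · have h₆ := hpred (i + 1) (by omega)
        have h₇ : x.partialSum (i + 2) = v := by rw [hi, hxj]
        rw [if_neg (by omega), if_pos hi, if_neg (by omega)]
        omega
      · split_ifs <;> first | contradiction | omega
  refine supIrred_of_forall_le (m := m) ?_ fun b hb hne i => ?_
  · rw [balanced_le_iff hj hv hx, hm, if_pos rfl]
    omega
  · rw [hm]
    split_ifs with hi
    · subst hi
      by_contra! hlt
      exact hne (le_antisymm hb ((balanced_le_iff hj hv hx).2 (by omega)))
    · exact hb i

theorem supIrred_balanced_of_lt_two_mul {x : IntPartition n} {j : ℕ} (hjn : j < n)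
    (hn : n < 2 * j) (hx : ∀ i, x.partialSum i = balancedSum n j n i) : SupIrred x := by
  -- Here `m` has one `2` fewer than `x`, and `j + 1` nonzero parts. Anything strictly below `x` has
  -- at least `j + 1` nonzero parts, which caps its partial sums by `i + (n - j - 1)` for `i ≤ j`.
  obtain ⟨m, hm⟩ : ∃ m : IntPartition n, ∀ i, m.partialSum i =
      min (min (2 * i) (i + (n - j - 1))) n :=
    exists_partialSum_eq _ (by simp) (fun i hi => by omega) (fun i => by omega) fun i => by omega
  have h₁ : n / j = 1 := by
    rw [Nat.div_eq_iff (by omega)]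
    omega
  have h₂ : n % j = n - j := by rw [Nat.mod_eq_sub_mod hjn.le, Nat.mod_eq_of_lt (by omega)]
  refine supIrred_of_forall_le (m := m) ?_ fun b hb hne i => ?_
  · rw [balanced_le_iff (by omega) le_rfl hx, hm]
    omega
  · have h₃ : b.partialSum j < n := by
      by_contra! hlt
      exact hne (le_antisymm hb ((balanced_le_iff (by omega) le_rfl hx).2 hlt))
    have h₄ := b.partialSum_le i
    have h₅ := hb i
    rw [hx, balancedSum, h₁, h₂] at h₅
    rw [hm]
    split_ifs at h₅ with hi
    · obtain ⟨d, hd⟩ := Nat.exists_eq_add_of_le hi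
      have h₆ := b.min_add_le_partialSum i d
      rw [← hd] at h₆
      omega
    · omega

/-! ### Counting join-irreducibles -/

/-- Index set for the join-irreducible partitions: pairs of a sum `v` and a number of parts. -/
def joinIndex (n : ℕ) : Finset (Σ _ : ℕ, ℕ) :=
  (Finset.range (n + 1)).sigma fun v => if v = n then Finset.Icc 1 (n - 1) else Finset.Icc 1 (v / 3)

theorem mem_joinIndex {v j : ℕ} :
    (⟨v, j⟩ : Σ _ : ℕ, ℕ) ∈ joinIndex n ↔ v ≤ n ∧ 1 ≤ j ∧ j < v ∧ (v = n ∨ 3 * j ≤ v) := by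
  simp only [joinIndex, Finset.mem_sigma, Finset.mem_range]
  split_ifs with h <;> rw [Finset.mem_Icc] <;> omega

theorem supIrred_iff {a : IntPartition n} : SupIrred a ↔
    ∃ p ∈ joinIndex n, ∀ i, a.partialSum i = balancedSum n p.2 p.1 i := by
  constructor
  · intro ha
    obtain ⟨j, v, hj, hjv, hv, hx⟩ := exists_balanced_of_supIrred ha
    by_cases hS : v = n ∨ 3 * j ≤ v
    · exact ⟨⟨v, j⟩, mem_joinIndex.2 ⟨hv, hj, hjv, hS⟩, hx⟩
    · rcases le_or_gt v (2 * j) with h2 | h2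
      · refine ⟨⟨n, n - (v - j)⟩, mem_joinIndex.2 (by omega), fun i => ?_⟩
        rw [hx, balancedSum_eq_of_le_two_mul hjv h2 (by omega)]
      · obtain ⟨r, rfl⟩ := Nat.exists_eq_add_of_le h2.le
        exact absurd ha (not_supIrred_balanced (by omega) (by omega) (by omega) hx)
  · rintro ⟨⟨v, j⟩, hp, hx⟩
    obtain ⟨hv, hj, hjv, hS⟩ := mem_joinIndex.1 hp
    rcases le_or_gt (2 * j) v with h2 | h2
    · exact supIrred_balanced hj h2 hv hS hx
    · obtain rfl : v = n := by omega
      exact supIrred_balanced_of_lt_two_mul hjv h2 hx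

/-- If `j < j'`, parts `j` and `j + 1` both lie in the even stretch of length `j'` and differ by at
most one. But `3 * j ≤ v` with `v < n` forces a gap of two, and `v = n` makes part `j'` zero
although `v' / j'` is positive. -/
theorem balancedSum_index_le {v j v' j' : ℕ} (hp : (⟨v, j⟩ : Σ _ : ℕ, ℕ) ∈ joinIndex n)
    (hp' : (⟨v', j'⟩ : Σ _ : ℕ, ℕ) ∈ joinIndex n)
    (h : ∀ i, balancedSum n j v i = balancedSum n j' v' i) : j' ≤ j := by
  rw [mem_joinIndex] at hp hp'
  by_contra! hlt
  obtain ⟨i, rfl⟩ := Nat.exists_eq_add_of_le' hp.2.1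
  have h₁ := balancedSum_pred (n := n) (v := v) (rfl : i + 1 = i + 1)
  have h₂ := balancedSum_self n v hp.2.1
  have h₃ : balancedSum n (i + 1) v (i + 2) = _ :=
    balancedSum_of_ge hp.2.1 hp.1 (by omega)
  have h₄ := balancedSum_gap (n := n) (v := v') (show i + 2 ≤ j' by omega)
  rw [← h, ← h, ← h] at h₄
  rcases hp.2.2.2 with hv | hv
  · obtain ⟨k, rfl⟩ := Nat.exists_eq_add_of_lt hlt
    have h₅ := balancedSum_pred (n := n) (v := v') (rfl : i + 1 + k + 1 = i + 1 + k + 1)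
    have h₆ : 1 ≤ v' / (i + 1 + k + 1) := (Nat.one_le_div_iff (by omega)).2 (by omega)
    rw [← h, balancedSum_of_ge hp.2.1 hp.1 (by omega)] at h₅
    omega
  · have h₅ : 3 ≤ v / (i + 1) := (Nat.le_div_iff_mul_le hp.2.1).2 hv
    omega

theorem ncard_joinIrreducibles (n : ℕ) :
    (joinIrreducibles (IntPartition n)).ncard = (joinIndex n).card := by
  have key : ∀ p : joinIndex n, ∃ a : IntPartition n,
      ∀ i, a.partialSum i = balancedSum n p.1.2 p.1.1 i := by
    rintro ⟨⟨v, j⟩, hp⟩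
    obtain ⟨hv, hj, hjv, -⟩ := mem_joinIndex.1 hp
    exact exists_balanced hj hjv.le hv
  choose f hf using key
  have hinj : Function.Injective f := by
    rintro ⟨⟨v, j⟩, hp⟩ ⟨⟨v', j'⟩, hp'⟩ h
    have hs : ∀ i, balancedSum n j v i = balancedSum n j' v' i := fun i => by
      have h₁ := hf ⟨⟨v, j⟩, hp⟩ i
      have h₂ := hf ⟨⟨v', j'⟩, hp'⟩ i
      rw [h] at h₁
      exact h₁.symm.trans h₂
    obtain rfl : j = j' := le_antisymm (balancedSum_index_le hp' hp fun i => (hs i).symm)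
      (balancedSum_index_le hp hp' hs)
    have hj := (mem_joinIndex.1 hp).2.1
    obtain rfl : v = v' := by
      rw [← balancedSum_self n v hj, hs, balancedSum_self n v' hj]
    rfl
  have hrange : joinIrreducibles (IntPartition n) = Set.range f := by
    ext a
    change SupIrred a ↔ _
    rw [supIrred_iff]
    constructor
    · rintro ⟨p, hp, ha⟩
      exact ⟨⟨p, hp⟩, partialSum_injective fun i => by rw [hf, ha]⟩
    · rintro ⟨p, rfl⟩
      exact ⟨p.1, p.2, hf p⟩
  rw [hrange, ← Nat.card_coe_set_eq, Nat.card_range_of_injective hinj, Nat.card_eq_fintype_card,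
    Fintype.card_coe]

theorem card_joinIndex_succ (n : ℕ) :
    (joinIndex (n + 1)).card = ∑ v ∈ Finset.range (n + 1), v / 3 + n := by
  rw [joinIndex, Finset.card_sigma, Finset.sum_range_succ, if_pos rfl, Nat.card_Icc]
  congr 1
  refine Finset.sum_congr rfl fun v hv => ?_
  rw [if_neg (Finset.mem_range.1 hv).ne, Nat.card_Icc, Nat.add_sub_cancel]

theorem two_mul_sum_range_div_three (n : ℕ) :
    2 * ∑ v ∈ Finset.range (n + 1), v / 3 + 3 * (n / 3) ^ 2 + n / 3 = 2 * n * (n / 3) := by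
  induction n with
  | zero => simp
  | succ n ih =>
    rw [Finset.sum_range_succ]
    -- The quotient jumps only when `n` is `2` modulo `3`.
    by_cases h : (n + 1) / 3 = n / 3
    · rw [h]
      linarith
    · have h₁ : (n + 1) / 3 = n / 3 + 1 := by omega
      have h₂ : n = 3 * (n / 3) + 2 := by omega
      rw [h₁]
      generalize n / 3 = q at *
      subst h₂
      linarith

theorem ncard_joinIrreducibles_succ (n : ℕ) :
    ((joinIrreducibles (IntPartition (n + 1))).ncard : ℝ) =
      n * ((⌊(n : ℝ) / 3⌋₊ : ℝ) + 1) - 3 / 2 * (⌊(n : ℝ) / 3⌋₊ : ℝ) ^ 2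
        - 1 / 2 * (⌊(n : ℝ) / 3⌋₊ : ℝ) := by
  have hfloor : ⌊(n : ℝ) / 3⌋₊ = n / 3 := by simpa using Nat.floor_div_eq_div (K := ℝ) n 3
  have h := two_mul_sum_range_div_three n
  rw [ncard_joinIrreducibles, card_joinIndex_succ, hfloor]
  generalize n / 3 = q at *
  generalize ∑ v ∈ Finset.range (n + 1), v / 3 = s at *
  rify at h
  push_cast
  linarith

/-! ### Quadratic growth -/

/-- The true leading term is `n ^ 2 / 6`; the constants `1 / 32` and `1` leave slack for lower-order
terms. -/
theorem ncard_joinIrreducibles_bounds {n : ℕ} (hn : 8 ≤ n) :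
    (n : ℝ) ^ 2 / 32 ≤ (joinIrreducibles (IntPartition n)).ncard ∧
      ((joinIrreducibles (IntPartition n)).ncard : ℝ) ≤ n ^ 2 := by
  obtain ⟨m, rfl⟩ := Nat.exists_eq_add_of_le' (show 1 ≤ n by omega)
  have h₁ := two_mul_sum_range_div_three m
  have h₂ : 3 * (m / 3) ≤ m := Nat.mul_div_le m 3
  have h₃ : m < 3 * (m / 3) + 3 := by omega
  rw [ncard_joinIrreducibles, card_joinIndex_succ]
  generalize m / 3 = q at *
  generalize ∑ v ∈ Finset.range (m + 1), v / 3 = s at *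
  have h₄ : (7 : ℝ) ≤ m := by exact_mod_cast (by omega : 7 ≤ m)
  have h₅ : (m : ℝ) + 1 ≤ 3 * q + 3 := by exact_mod_cast h₃
  rify at h₁ h₂
  have hq : (0 : ℝ) ≤ q := Nat.cast_nonneg q
  push_cast
  constructor <;> nlinarith

theorem card_meetIrreducibles_bounds {n : ℕ} (hn : 6 ≤ n) :
    (n : ℝ) ^ 2 / 48 ≤ Nat.card (meetIrreducibles (IntPartition n)) ∧
      (Nat.card (meetIrreducibles (IntPartition n)) : ℝ) ≤ 4 * n ^ 2 := by
  have h₁ := card_meetIrreducibles_le n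
  have h₂ := le_card_meetIrreducibles n
  generalize Nat.card (meetIrreducibles (IntPartition n)) = N at *
  -- Each floor loses at most a factor two, whence `48 = 12 * 4`.
  have h₃ : n ≤ 12 * (n / 6) := by omega
  have h₄ : n ≤ 4 * (n / 2) := by omega
  generalize n / 6 = p at *
  generalize n / 2 = q at *
  rify at *
  constructor <;> nlinarith

end IntPartition

theorem isTheta_sq_of_bounds {f : ℕ → ℕ} {c d : ℝ} {m : ℕ} (hc : 0 < c)
    (h : ∀ n, m ≤ n → (n : ℝ) ^ 2 / c ≤ f n ∧ (f n : ℝ) ≤ d * n ^ 2) :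
    Asymptotics.IsTheta Filter.atTop (fun n => (f n : ℝ)) (fun n : ℕ => (n : ℝ) ^ 2) := by
  refine ⟨Asymptotics.IsBigO.of_bound d ?_, Asymptotics.IsBigO.of_bound c ?_⟩
  · filter_upwards [Filter.eventually_ge_atTop m] with n hn
    simpa using (h n hn).2
  · filter_upwards [Filter.eventually_ge_atTop m] with n hn
    have := (h n hn).1
    rw [div_le_iff₀' hc] at this
    simpa using this

theorem mainTheorem2 :
    (∀ n : ℕ, 1 ≤ n →
      ((joinIrreducibles (IntPartition (n + 1))).ncard : ℝ)
        = n * ((⌊(n : ℝ) / 3⌋₊ : ℝ) + 1) - 3 / 2 * (⌊(n : ℝ) / 3⌋₊ : ℝ) ^ 2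
          - 1 / 2 * (⌊(n : ℝ) / 3⌋₊ : ℝ)) ∧
    Asymptotics.IsTheta Filter.atTop
      (fun n : ℕ => (Nat.card (standardContext (IntPartition n)).Objects : ℝ))
      (fun n : ℕ => (n : ℝ) ^ 2) ∧
    Asymptotics.IsTheta Filter.atTop
      (fun n : ℕ => (Nat.card (standardContext (IntPartition n)).Attributes : ℝ))
      (fun n : ℕ => (n : ℝ) ^ 2) := by
  refine ⟨fun n _ => IntPartition.ncard_joinIrreducibles_succ n, ?_, ?_⟩
  · refine isTheta_sq_of_bounds (c := 32) (d := 1) (m := 8) (by norm_num) fun n hn => ?_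
    rw [one_mul]
    -- `Set.ncard` of the join-irreducibles and `Nat.card` of the object type agree by unfolding.
    exact IntPartition.ncard_joinIrreducibles_bounds hn
  · exact isTheta_sq_of_bounds (c := 48) (m := 6) (by norm_num) fun n hn =>
      IntPartition.card_meetIrreducibles_bounds hn
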